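/- Let $p\ge 2$ be a power of $2$, let $d,N,r,m,D$ be natural numbers and $k\ge 0$ a real number. Let $A$, $B$, $b$ be matrices of formal variables of sizes $d\times r$, $r\times N$, $r\times N$. A degree-$D$ pseudo-expectation is a linear functional $\tilde{\mathbb E}$ on the real polynomials of degree at most $D$ in these variables with $\tilde{\mathbb E}[1]=1$ and $\tilde{\mathbb E}[q^2]\ge 0$ whenever $\deg q\le D/2$; it satisfies a constraint $q=0$ if $\tilde{\mathbb E}[qs]=0$ for all polynomials $s$ with $\deg(qs)\le D$, and a constraint $q\ge 0$ if $\tilde{\mathbb E}[qs^2]\ge 0$ for all polynomials $s$ with $\deg(qs^2)\le D$. Let $Q^{\mathrm{sos}}_{p}\subset\mathbb R^{d\times N}$ be the set of real matrices $C$ for which there is a degree-$D$ pseudo-expectation that satisfies $$C=AB,\qquad B_{\ell j}=b_{\ell j}^{\,p-1}\ \ \forall \ell,j,\qquad \sum_{\ell=1}^r b_{\ell j}^{\,p}\le k^{p/(p-1)}\ \ \forall j,\qquad A_{i\ell}^2\le 1\ \ \forall i,\ell .$$ For $W\subset\mathbb R^{d\times N}$ and an integer $1\le m\le dN$, the sampling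 Rademacher width is $$\mathcal{SRW}_m(W)=\mathbb E_{\sigma,\Omega}\Big[\frac1m\sup_{x\in W}\sum_{(i,j)\in\Omega}x_{ij}\sigma_{ij}\Big],$$ where $\Omega$ is a uniformly random set of $m$ of the $dN$ entries and, independently, $\sigma$ is uniform in $\{\pm1\}^{d\times N}$. There are absolute constants $K_0,c_1,K>0$ such that the following holds. If $d\ge 2$, $N=d^{c_0p}$ with a real number $c_0\ge c_1$, $1\le m\le dN$ and $D\ge K_0p^2$, then $Q^{\mathrm{sos}}_p$ is nonempty and bounded (so that its sampling Rademacher width is well defined and finite), and $$\mathcal{SRW}_m(Q^{\mathrm{sos}}_p)\le K\sqrt{\frac{p^2\,N\,k^2\,r^{2/p}\log d}{m}}\,.$$ -/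

import Mathlib

open scoped BigOperators

noncomputable section

/-- The sampling Rademacher width of a set `W` of real vectors indexed by a finite set `ι`:
the average, over a uniformly random subset `Ω` of size `m` of the coordinates and uniformly random
independent signs `σ`, of `(1 / m) * sup_{x ∈ W} ∑_{i ∈ Ω} x i * σ i`. The supremum is a real one,
so it has its usual meaning when `W` is nonempty and bounded. -/
def samplingRademacherWidth {ι : Type*} [Fintype ι] [DecidableEq ι] (m : ℕ) (W : Set (ι → ℝ)) :
    ℝ :=
  𝔼 Ω ∈ Finset.powersetCard m (Finset.univ : Finset ι), 𝔼 σ : ι → ℤˣ,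
    (1 / (m : ℝ)) * sSup ((fun x : ι → ℝ => ∑ i ∈ Ω, x i * ((σ i : ℤ) : ℝ)) '' W)

/-- The real polynomials of total degree at most `D` in the variables `V`. -/
abbrev PolyLE (V : Type*) (D : ℕ) : Submodule ℝ (MvPolynomial V ℝ) :=
  MvPolynomial.restrictTotalDegree V ℝ D

theorem one_mem_polyLE (V : Type*) (D : ℕ) : (1 : MvPolynomial V ℝ) ∈ PolyLE V D := by
  simp [MvPolynomial.mem_restrictTotalDegree]

theorem sq_mem_polyLE {V : Type*} {D : ℕ} {q : MvPolynomial V ℝ} (h : 2 * q.totalDegree ≤ D) :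
    q ^ 2 ∈ PolyLE V D :=
  (MvPolynomial.mem_restrictTotalDegree _ _ _).2
    ((MvPolynomial.totalDegree_pow q 2).trans h)

/-- A degree-`D` pseudo-expectation in the variables `V`: a linear functional on the polynomials
of degree at most `D`, normalized and nonnegative on squares of polynomials of degree at most
`D / 2`. -/
structure PseudoExpectation (V : Type*) (D : ℕ) where
  /-- the underlying linear functional -/
  toLin : PolyLE V D →ₗ[ℝ] ℝ
  map_one : toLin ⟨1, one_mem_polyLE V D⟩ = 1
  sq_nonneg : ∀ (q : MvPolynomial V ℝ) (h : 2 * q.totalDegree ≤ D),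
    0 ≤ toLin ⟨q ^ 2, sq_mem_polyLE h⟩

/-- The pseudo-expectation satisfies the constraint `q = 0`: it vanishes on all multiples of `q` of
degree at most `D`. -/
def PseudoExpectation.SatisfiesEqZero {V : Type*} {D : ℕ} (E : PseudoExpectation V D)
    (q : MvPolynomial V ℝ) : Prop :=
  ∀ (s : MvPolynomial V ℝ) (h : q * s ∈ PolyLE V D), E.toLin ⟨q * s, h⟩ = 0

/-- The pseudo-expectation satisfies the constraint `0 ≤ q`: it is nonnegative on all products of
degree at most `D` of `q` with a square. -/
def PseudoExpectation.SatisfiesNonneg {V : Type*} {D : ℕ} (E : PseudoExpectation V D)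
    (q : MvPolynomial V ℝ) : Prop :=
  ∀ (s : MvPolynomial V ℝ) (h : q * s ^ 2 ∈ PolyLE V D), 0 ≤ E.toLin ⟨q * s ^ 2, h⟩

/-- The formal variables of the relaxation: the entries of a `d × r` matrix `A` and of two `r × N`
matrices `B` and `b`. -/
inductive FactorVar (d r N : ℕ) : Type
  | A (i : Fin d) (l : Fin r) : FactorVar d r N
  | B (l : Fin r) (j : Fin N) : FactorVar d r N
  | b (l : Fin r) (j : Fin N) : FactorVar d r N

/-- The pseudo-expectation satisfies the constraints `B l j = (b l j) ^ (p - 1)`,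
`∑ l, (b l j) ^ p ≤ k ^ (p / (p - 1))`, `(A i l) ^ 2 ≤ 1`, and `C = A B`. -/
structure SatisfiesFactorConstraints {d r N D : ℕ} (p : ℕ) (k : ℝ)
    (C : Matrix (Fin d) (Fin N) ℝ) (E : PseudoExpectation (FactorVar d r N) D) : Prop where
  eq_pow : ∀ (l : Fin r) (j : Fin N), E.SatisfiesEqZero
    (MvPolynomial.X (FactorVar.B l j) - MvPolynomial.X (FactorVar.b l j) ^ (p - 1))
  sum_le : ∀ j : Fin N, E.SatisfiesNonneg
    (MvPolynomial.C (k ^ ((p : ℝ) / ((p : ℝ) - 1))) -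
      ∑ l : Fin r, MvPolynomial.X (FactorVar.b l j) ^ p)
  sq_le : ∀ (i : Fin d) (l : Fin r), E.SatisfiesNonneg
    (1 - MvPolynomial.X (FactorVar.A i l) ^ 2)
  eq_mul : ∀ (i : Fin d) (j : Fin N), E.SatisfiesEqZero
    (MvPolynomial.C (C i j) -
      ∑ l : Fin r, MvPolynomial.X (FactorVar.A i l) * MvPolynomial.X (FactorVar.B l j))

/-- The degree-`D` sum-of-squares relaxation of the set of the products `A B` of a `d × r` matrix
`A` with entries in `[-1, 1]` and an `r × N` matrix `B` whose columns have `ℓ₁` norm at most `k`. -/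
def sosRelaxation (d N r p D : ℕ) (k : ℝ) : Set (Matrix (Fin d) (Fin N) ℝ) :=
  {C | ∃ E : PseudoExpectation (FactorVar d r N) D, SatisfiesFactorConstraints p k C E}

/-- The vector of the entries of a matrix. -/
def matrixEntries {d N : ℕ} (C : Matrix (Fin d) (Fin N) ℝ) : Fin d × Fin N → ℝ :=
  fun ij => C ij.1 ij.2

end

/-! Write `M` for the sign matrix restricted to `Ω`, and put `x l j = ∑ i, M i j * A i l`. The
constraints turn `⟨M, C⟩` into the sum over `l, j` of the pseudo-expectations of `x l j * b l j ^ (p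
- 1)`. Since `p` is a power of 2, Young's inequality `p x y^(p-1) ≤ x^p + (p-1) y^p` has a
sum-of-squares proof in degree `p` (`young_two_pow`). The `b` part is controlled by its constraint.
Expanding `x l j ^ p` over words `α : Fin p → Fin d`, and using that monomials of degree `p` in `A`
have pseudo-expectation in `[-1, 1]`, bounds the other part by `r ∑ α, |∑ j, ∏ t, M (α t) j|`, a
quantity free of `C` (`sum_mul_le_of_mem_sosRelaxation`).

It remains to average over `σ` and `Ω`; let `q = p / 2`. A word with more than `q` distinct letters
has a letter occurring once, so its column products are uncorrelated and their sum has second moment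
at most `N`. As `N ≥ d ^ (2 * p)`, all such words together contribute at most `N`. The other words
are few: column `j` sees at most `q ^ p * n_j ^ q` of them, where `n_j` is the number of its sampled
entries, and the `q`-th moment of `n_j` is at most `(q + m / N) ^ q`.

For `m / N ≥ q`, optimal weights in Young's inequality give the bound. For smaller `m`, bounding
each entry of `C` by about `r ^ (1 / p) * k` suffices. -/

/-! ### Inequalities for pseudo-expectations -/

/-- A functional on all polynomials needs no membership proofs; positivity is still claimed only in
low degree. -/
theorem PseudoExpectation.exists_extension {V : Type*} {D : ℕ} (E : PseudoExpectation V D) :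
    ∃ f : MvPolynomial V ℝ →ₗ[ℝ] ℝ, ∀ q (h : q ∈ PolyLE V D), E.toLin ⟨q, h⟩ = f q := by
  obtain ⟨f, hf⟩ := E.toLin.exists_extend
  exact ⟨f, fun q h => by rw [← hf]; rfl⟩

/-- Induction by doubling: with `P = 2 ^ a`, the square of `x y^(P-1) - y^P` gives `2 x y^(2P-1) ≤
x² y^(2P-2) + y^(2P)`, and the case `P` for `x², y²` bounds the first term on the right. The degree
bound `n` varies because it doubles as well. -/
theorem young_two_pow {V : Type*} {D : ℕ} (f : MvPolynomial V ℝ →ₗ[ℝ] ℝ)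
    (hsq : ∀ q : MvPolynomial V ℝ, 2 * q.totalDegree ≤ D → 0 ≤ f (q ^ 2)) (a : ℕ) :
    ∀ (n : ℕ) (x y : MvPolynomial V ℝ), x.totalDegree ≤ n → y.totalDegree ≤ n → 2 ^ a * n ≤ D →
      (2 : ℝ) ^ a * f (x * y ^ (2 ^ a - 1)) ≤
        f (x ^ 2 ^ a) + ((2 : ℝ) ^ a - 1) * f (y ^ 2 ^ a) := by
  induction a with
  | zero => intro n x y _ _ _; simp
  | succ a ih =>
    intro n x y hx hy hD
    have h1 := ih (2 * n) (x ^ 2) (y ^ 2)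
      ((MvPolynomial.totalDegree_pow x 2).trans (by omega))
      ((MvPolynomial.totalDegree_pow y 2).trans (by omega)) (by rw [pow_succ] at hD; linarith)
    obtain ⟨Q, hQ⟩ : ∃ Q, 2 ^ a = Q + 1 := ⟨2 ^ a - 1, by have := Nat.one_le_two_pow (n := a); omega⟩
    have hdeg : (x * y ^ Q - y ^ (Q + 1)).totalDegree ≤ (Q + 1) * n := by
      refine (MvPolynomial.totalDegree_sub _ _).trans (max_le ?_ ?_)
      · refine (MvPolynomial.totalDegree_mul _ _).trans ?_
        have := (MvPolynomial.totalDegree_pow y Q).trans (Nat.mul_le_mul_left Q hy)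
        linarith
      · exact (MvPolynomial.totalDegree_pow y _).trans (Nat.mul_le_mul_left _ hy)
    have h2 := hsq (x * y ^ Q - y ^ (Q + 1)) (by
      rw [pow_succ, hQ] at hD; linarith)
    have e1 : (x * y ^ Q - y ^ (Q + 1)) ^ 2 =
        x ^ 2 * (y ^ 2) ^ Q - (2 : ℝ) • (x * y ^ (2 * Q + 1)) + y ^ (2 * (Q + 1)) := by
      rw [two_smul]; ring
    rw [e1, map_add, map_sub, map_smul, smul_eq_mul] at h2
    have hc : (2 : ℝ) ^ a = Q + 1 := by exact_mod_cast hQ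
    rw [hc, hQ, ← pow_mul, ← pow_mul] at h1
    have e2 : 2 ^ (a + 1) = 2 * (Q + 1) := by rw [pow_succ, hQ]; ring
    rw [e2, pow_succ, hc, show 2 * (Q + 1) - 1 = 2 * Q + 1 by omega]
    rw [show Q + 1 - 1 = Q by omega] at h1
    have hQ0 : (0 : ℝ) ≤ Q + 1 := by positivity
    simp only [← pow_mul] at h1 h2
    nlinarith [mul_nonneg hQ0 h2]

theorem totalDegree_prod_le_card {V ι : Type*} (v : ι → MvPolynomial V ℝ)
    (hv : ∀ i, (v i).totalDegree ≤ 1) (S : Finset ι) : (∏ i ∈ S, v i).totalDegree ≤ S.card := by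
  refine (MvPolynomial.totalDegree_finsetProd S v).trans ?_
  simpa using Finset.sum_le_sum fun i (_ : i ∈ S) => hv i

/-- Factors are removed one at a time, each time testing `1 - v i ^ 2` against the square of the
remaining product. -/
theorem map_sq_prod_le_one {V ι : Type*} {D : ℕ} (f : MvPolynomial V ℝ →ₗ[ℝ] ℝ) (h1 : f 1 = 1)
    (v : ι → MvPolynomial V ℝ) (hv : ∀ i, (v i).totalDegree ≤ 1)
    (hle : ∀ i (s : MvPolynomial V ℝ), 2 + 2 * s.totalDegree ≤ D → 0 ≤ f ((1 - v i ^ 2) * s ^ 2))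
    (S : Finset ι) (hS : 2 * S.card ≤ D) : f ((∏ i ∈ S, v i) ^ 2) ≤ 1 := by
  classical
  induction S using Finset.induction_on with
  | empty => simp [h1]
  | insert i S hi ih =>
    rw [Finset.card_insert_of_notMem hi] at hS
    have h2 := ih (by omega)
    have h3 := hle i (∏ i ∈ S, v i) (by
      have := totalDegree_prod_le_card v hv S
      omega)
    rw [Finset.prod_insert hi]
    have e : (v i * ∏ i ∈ S, v i) ^ 2 =
      (∏ i ∈ S, v i) ^ 2 - (1 - v i ^ 2) * (∏ i ∈ S, v i) ^ 2 := by ring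
    rw [e, map_sub]
    linarith

/-- Split the product into halves `x, y` of `q` factors; then `±2xy ≤ x² + y²`, and both squares
have value at most 1. -/
theorem abs_map_prod_le_one {V ι : Type*} [Fintype ι] {D q : ℕ} (f : MvPolynomial V ℝ →ₗ[ℝ] ℝ)
    (h1 : f 1 = 1)
    (hsq : ∀ q : MvPolynomial V ℝ, 2 * q.totalDegree ≤ D → 0 ≤ f (q ^ 2))
    (v : ι → MvPolynomial V ℝ) (hv : ∀ i, (v i).totalDegree ≤ 1)
    (hle : ∀ i (s : MvPolynomial V ℝ), 2 + 2 * s.totalDegree ≤ D → 0 ≤ f ((1 - v i ^ 2) * s ^ 2))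
    (hq : Fintype.card ι = 2 * q) (hD : 2 * q ≤ D) : |f (∏ i, v i)| ≤ 1 := by
  classical
  obtain ⟨S, -, hS⟩ := Finset.exists_subset_card_eq
    (show q ≤ (Finset.univ : Finset ι).card by rw [Finset.card_univ]; omega)
  have hS' : Sᶜ.card = q := by rw [Finset.card_compl]; omega
  rw [← Finset.prod_mul_prod_compl S]
  have a1 := map_sq_prod_le_one f h1 v hv hle S (by omega)
  have a2 := map_sq_prod_le_one f h1 v hv hle Sᶜ (by omega)
  have d1 := totalDegree_prod_le_card v hv S
  have d2 := totalDegree_prod_le_card v hv Sᶜ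
  set x := ∏ i ∈ S, v i
  set y := ∏ i ∈ Sᶜ, v i
  have b1 := hsq (x + y) (by have := MvPolynomial.totalDegree_add x y; omega)
  have b2 := hsq (x - y) (by have := MvPolynomial.totalDegree_sub x y; omega)
  have e1 : (x + y) ^ 2 = x ^ 2 + (2 : ℝ) • (x * y) + y ^ 2 := by rw [two_smul]; ring
  have e2 : (x - y) ^ 2 = x ^ 2 - (2 : ℝ) • (x * y) + y ^ 2 := by rw [two_smul]; ring
  rw [e1, map_add, map_add, map_smul, smul_eq_mul] at b1
  rw [e2, map_add, map_sub, map_smul, smul_eq_mul] at b2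
  rw [abs_le]; constructor <;> linarith

/-! ### Sampling without replacement, and counting words -/

theorem card_powersetCard_filter_superset {ι : Type*} [Fintype ι] [DecidableEq ι] (m : ℕ)
    (S : Finset ι) (hS : S.card ≤ m) :
    ((Finset.powersetCard m (Finset.univ : Finset ι)).filter (S ⊆ ·)).card =
      (Fintype.card ι - S.card).choose (m - S.card) := by
  rw [← Finset.card_compl, ← Finset.card_powersetCard]
  symm
  refine Finset.card_bij' (fun T _ => T ∪ S) (fun T _ => T \ S) ?_ ?_ ?_ ?_
  · intro T hT
    rw [Finset.mem_powersetCard] at hT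
    have hd : Disjoint T S := by
      rw [Finset.disjoint_left]; intro x hx; simpa using hT.1 hx
    simp only [Finset.mem_filter, Finset.mem_powersetCard, Finset.subset_univ, true_and]
    exact ⟨by rw [Finset.card_union_of_disjoint hd]; omega, Finset.subset_union_right⟩
  · intro T hT
    simp only [Finset.mem_filter, Finset.mem_powersetCard, Finset.subset_univ, true_and] at hT
    rw [Finset.mem_powersetCard]
    refine ⟨fun x hx => by simp at hx ⊢; exact hx.2, ?_⟩
    rw [Finset.card_sdiff_of_subset hT.2]; omega
  · intro T hT
    rw [Finset.mem_powersetCard] at hT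
    have hd : Disjoint T S := by
      rw [Finset.disjoint_left]; intro x hx; simpa using hT.1 hx
    exact Finset.union_sdiff_cancel_right hd
  · intro T hT
    simp only [Finset.mem_filter] at hT
    exact Finset.sdiff_union_of_subset hT.2

/-- The ratio of the binomials is `∏ i < s, (m - i) / (n - i)`, and each factor is at most `m / n`.
-/
theorem choose_sub_mul_pow_le (s : ℕ) : ∀ n m : ℕ, m ≤ n → s ≤ m →
    (n - s).choose (m - s) * n ^ s ≤ n.choose m * m ^ s := by
  induction s with
  | zero => intro n m _ _; simp
  | succ s ih =>
    intro n m hmn hs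
    obtain ⟨m, rfl⟩ : ∃ m', m = m' + 1 := ⟨m - 1, by omega⟩
    obtain ⟨n, rfl⟩ : ∃ n', n = n' + 1 := ⟨n - 1, by omega⟩
    have h1 := ih n m (by omega) (by omega)
    have h2 := Nat.add_one_mul_choose_eq n m
    rw [Nat.add_sub_add_right, Nat.add_sub_add_right]
    have h3 : m * (n + 1) ≤ n * (m + 1) := by nlinarith
    have h4 : m ^ s * (n + 1) ^ s ≤ n ^ s * (m + 1) ^ s := by
      rw [← mul_pow, ← mul_pow]; exact Nat.pow_le_pow_left h3 s
    rcases Nat.eq_zero_or_pos n with rfl | hn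
    · have : m = 0 := by omega
      subst this
      simp
    · have hn' : 0 < n ^ s := by positivity
      refine Nat.le_of_mul_le_mul_left ?_ hn'
      calc n ^ s * ((n - s).choose (m - s) * (n + 1) ^ (s + 1))
          = ((n - s).choose (m - s) * n ^ s) * (n + 1) ^ s * (n + 1) := by ring
        _ ≤ (n.choose m * m ^ s) * (n + 1) ^ s * (n + 1) := by gcongr
        _ = (m ^ s * (n + 1) ^ s) * ((n + 1) * n.choose m) := by ring
        _ ≤ (n ^ s * (m + 1) ^ s) * ((n + 1) * n.choose m) := by gcongr
        _ = n ^ s * ((n + 1).choose (m + 1) * (m + 1) ^ (s + 1)) := by rw [h2]; ring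

theorem expect_ite_subset_le {ι : Type*} [Fintype ι] [DecidableEq ι] (m : ℕ)
    (hm : m ≤ Fintype.card ι) (S : Finset ι) :
    𝔼 Ω ∈ Finset.powersetCard m (Finset.univ : Finset ι), (if S ⊆ Ω then (1 : ℝ) else 0) ≤
      ((m : ℝ) / Fintype.card ι) ^ S.card := by
  rw [Finset.expect_eq_sum_div_card, Finset.card_powersetCard, Finset.card_univ,
    Finset.sum_boole]
  by_cases hS : S.card ≤ m
  · rw [card_powersetCard_filter_superset m S hS, div_pow]
    have h0 : 0 < (Fintype.card ι).choose m := Nat.choose_pos hm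
    rcases Nat.eq_zero_or_pos (Fintype.card ι) with h | h
    · have : S.card = 0 := by omega
      simp [this]
      exact div_self_le_one _
    · rw [div_le_div_iff₀ (by exact_mod_cast h0) (by positivity), mul_comm ((m : ℝ) ^ _)]
      exact_mod_cast choose_sub_mul_pow_le S.card _ m hm hS
  · rw [Finset.filter_false_of_mem]
    · simp; positivity
    · intro Ω hΩ hSΩ
      rw [Finset.mem_powersetCard] at hΩ
      have := Finset.card_le_card hSΩ
      omega

/-- Build the word letter by letter: a new letter either repeats one of at most `c` earlier ones or
costs a factor `x`. Keeping `c` apart from `q` fixes the base during the induction. -/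
theorem sum_pow_card_image_le {κ : Type*} [Fintype κ] [DecidableEq κ] {x : ℝ} (hx : 0 ≤ x)
    (q : ℕ) : ∀ c : ℕ, q ≤ c →
    ∑ β : Fin q → κ, x ^ (Finset.univ.image β).card ≤ (c + Fintype.card κ * x) ^ q := by
  induction q with
  | zero => intro c _; simp
  | succ q ih =>
    intro c hc
    rw [← (Fin.consEquiv (fun _ : Fin (q + 1) => κ)).sum_comp, Fintype.sum_prod_type_right]
    have key : ∀ β : Fin q → κ, ∑ a : κ,
        x ^ (Finset.univ.image (Fin.consEquiv (fun _ : Fin (q + 1) => κ) (a, β))).card ≤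
          (c + Fintype.card κ * x) * x ^ (Finset.univ.image β).card := by
      intro β
      have h1 : ∀ a : κ,
          x ^ (Finset.univ.image (Fin.consEquiv (fun _ : Fin (q + 1) => κ) (a, β))).card ≤
            (if a ∈ Finset.univ.image β then x ^ (Finset.univ.image β).card else 0) +
              x * x ^ (Finset.univ.image β).card := by
        intro a
        have h2 : Finset.univ.image (Fin.consEquiv (fun _ : Fin (q + 1) => κ) (a, β)) =
            insert a (Finset.univ.image β) := by
          ext b
          simp [Fin.consEquiv, Fin.exists_fin_succ, eq_comm]
        rw [h2]
        split_ifs with h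
        · rw [Finset.insert_eq_of_mem h]
          have : 0 ≤ x * x ^ (Finset.univ.image β).card := by positivity
          linarith
        · rw [Finset.card_insert_of_notMem h, pow_succ]
          exact le_of_eq (by ring)
      refine (Finset.sum_le_sum fun a _ => h1 a).trans ?_
      rw [Finset.sum_add_distrib, Finset.sum_const, Finset.sum_ite_mem, Finset.univ_inter,
        Finset.sum_const, Finset.card_univ, nsmul_eq_mul, nsmul_eq_mul, add_mul, mul_assoc]
      have h3 : ((Finset.univ.image β).card : ℝ) ≤ c := by
        have : (Finset.univ.image β).card ≤ q := by
          simpa using Finset.card_image_le (s := Finset.univ) (f := β)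
        exact_mod_cast (by omega : (Finset.univ.image β).card ≤ c)
      gcongr
    refine (Finset.sum_le_sum fun β _ => key β).trans ?_
    rw [← Finset.mul_sum, pow_succ']
    have := ih c (by omega)
    gcongr

/-- Such a word factors as `Fin p → Fin q → T`. -/
theorem card_words_le {p q d : ℕ} (hp : 0 < p) (T : Finset (Fin d)) :
    (Finset.univ.filter fun α : Fin p → Fin d =>
      (∀ t, α t ∈ T) ∧ (Finset.univ.image α).card ≤ q).card ≤ q ^ p * T.card ^ q := by
  classical
  have hsub : (Finset.univ.filter fun α : Fin p → Fin d =>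
      (∀ t, α t ∈ T) ∧ (Finset.univ.image α).card ≤ q) ⊆
      ((Finset.univ : Finset (Fin p → Fin q)) ×ˢ Fintype.piFinset fun _ : Fin q => T).image
        fun x => x.2 ∘ x.1 := by
    intro α hα
    simp only [Finset.mem_filter, Finset.mem_univ, true_and] at hα
    obtain ⟨hT, hc⟩ := hα
    obtain ⟨e⟩ : Nonempty ({x // x ∈ Finset.univ.image α} ↪ Fin q) :=
      Function.Embedding.nonempty_of_card_le (by rw [Fintype.card_coe]; simpa using hc)
    have : Nonempty {x // x ∈ Finset.univ.image α} :=
      ⟨⟨α ⟨0, hp⟩, by simp⟩⟩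
    simp only [Finset.mem_image, Finset.mem_product, Finset.mem_univ, true_and,
      Fintype.mem_piFinset, Prod.exists]
    refine ⟨fun t => e ⟨α t, by simp⟩, fun c => (Function.invFun e c).1, fun c => ?_, ?_⟩
    · have := (Function.invFun e c).2
      simp only [Finset.mem_image, Finset.mem_univ, true_and] at this
      obtain ⟨t, ht⟩ := this
      change (Function.invFun e c).1 ∈ T
      rw [← ht]; exact hT t
    · funext t
      simp [Function.leftInverse_invFun e.injective _]
  refine (Finset.card_le_card hsub).trans (Finset.card_image_le.trans ?_)
  simp

theorem exists_card_fiber_eq_one {p q : ℕ} {κ : Type*} [DecidableEq κ] (hp : p = 2 * q)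
    (α : Fin p → κ) (h : q < (Finset.univ.image α).card) :
    ∃ i, (Finset.univ.filter fun t => α t = i).card = 1 := by
  by_contra! hne
  have h1 := Finset.card_eq_sum_card_image α Finset.univ
  have h2 : ∑ b ∈ Finset.univ.image α, 2 ≤
      ∑ b ∈ Finset.univ.image α, (Finset.univ.filter fun t => α t = b).card := by
    refine Finset.sum_le_sum fun b hb => ?_
    obtain ⟨t, -, ht⟩ := Finset.mem_image.1 hb
    have h3 : 0 < (Finset.univ.filter fun t => α t = b).card :=
      Finset.card_pos.2 ⟨t, by simpa using ht⟩
    have := hne b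
    omega
  rw [← h1] at h2
  simp at h2
  omega

/-! ### Averaging over signs and sampled positions -/

/-- The entries of the sign matrix `σ` restricted to the positions in `Ω`. -/
def maskedSign {d N : ℕ} (Ω : Finset (Fin d × Fin N)) (σ : Fin d × Fin N → ℤˣ) (i : Fin d)
    (j : Fin N) : ℝ :=
  if (i, j) ∈ Ω then ((σ (i, j) : ℤ) : ℝ) else 0

theorem abs_maskedSign {d N : ℕ} (Ω : Finset (Fin d × Fin N)) (σ : Fin d × Fin N → ℤˣ) (i : Fin d)
    (j : Fin N) : |maskedSign Ω σ i j| = if (i, j) ∈ Ω then 1 else 0 := by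
  unfold maskedSign
  split_ifs
  · rcases Int.units_eq_one_or (σ (i, j)) with h | h <;> simp [h]
  · simp

theorem abs_prod_maskedSign {d N p : ℕ} (Ω : Finset (Fin d × Fin N)) (σ : Fin d × Fin N → ℤˣ)
    (α : Fin p → Fin d) (j : Fin N) :
    |∏ t, maskedSign Ω σ (α t) j| = if ∀ t, (α t, j) ∈ Ω then 1 else 0 := by
  rw [Finset.abs_prod]
  simp_rw [abs_maskedSign]
  rw [Finset.prod_ite_zero]
  simp

theorem abs_prod_maskedSign_le_one {d N p : ℕ} (Ω : Finset (Fin d × Fin N))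
    (σ : Fin d × Fin N → ℤˣ) (α : Fin p → Fin d) (j : Fin N) :
    |∏ t, maskedSign Ω σ (α t) j| ≤ 1 := by
  rw [abs_prod_maskedSign]; split_ifs <;> norm_num

theorem maskedSign_flip {d N : ℕ} (Ω : Finset (Fin d × Fin N)) (σ : Fin d × Fin N → ℤˣ)
    (e : Fin d × Fin N) (i : Fin d) (j : Fin N) :
    maskedSign Ω (Pi.mulSingle e (-1) * σ) i j =
      (if (i, j) = e then -1 else 1) * maskedSign Ω σ i j := by
  unfold maskedSign
  by_cases h : (i, j) = e
  · subst h; simp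
  · simp [h]

/-- Flipping the sign at `(i, j)` negates the product of column `j`, where `i` occurs once, and
leaves column `j'` alone. -/
theorem expect_prod_maskedSign_mul_eq_zero {d N p : ℕ} (Ω : Finset (Fin d × Fin N))
    (α : Fin p → Fin d) (i : Fin d) (hi : (Finset.univ.filter fun t => α t = i).card = 1)
    {j j' : Fin N} (hj : j ≠ j') :
    𝔼 σ : Fin d × Fin N → ℤˣ,
      (∏ t, maskedSign Ω σ (α t) j) * (∏ t, maskedSign Ω σ (α t) j') = 0 := by
  have h1 := Fintype.expect_equiv (Equiv.mulLeft (Pi.mulSingle (i, j) (-1) : Fin d × Fin N → ℤˣ))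
    (fun σ => -((∏ t, maskedSign Ω σ (α t) j) * (∏ t, maskedSign Ω σ (α t) j')))
    (fun σ => (∏ t, maskedSign Ω σ (α t) j) * (∏ t, maskedSign Ω σ (α t) j')) (by
      intro σ
      simp only [Equiv.coe_mulLeft, maskedSign_flip, Finset.prod_mul_distrib, Prod.mk.injEq,
        and_true, hj.symm, and_false, if_false, one_mul]
      rw [Finset.prod_ite]
      simp [hi])
  rw [Finset.expect_neg_distrib] at h1
  linarith

theorem expect_sq_sum_prod_maskedSign_le {d N p : ℕ} (Ω : Finset (Fin d × Fin N))
    (α : Fin p → Fin d) (i : Fin d) (hi : (Finset.univ.filter fun t => α t = i).card = 1) :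
    𝔼 σ : Fin d × Fin N → ℤˣ, (∑ j, ∏ t, maskedSign Ω σ (α t) j) ^ 2 ≤ N := by
  simp_rw [sq, Finset.sum_mul_sum]
  rw [Finset.expect_sum_comm]
  simp_rw [Finset.expect_sum_comm]
  have h : ∀ j : Fin N, ∑ j' : Fin N, 𝔼 σ : Fin d × Fin N → ℤˣ,
      (∏ t, maskedSign Ω σ (α t) j) * (∏ t, maskedSign Ω σ (α t) j') ≤ 1 := by
    intro j
    rw [Finset.sum_eq_single j]
    · refine Finset.expect_le Finset.univ_nonempty fun σ _ => ?_
      rw [← abs_mul_abs_self]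
      have := abs_prod_maskedSign_le_one Ω σ α j
      nlinarith [abs_nonneg (∏ t, maskedSign Ω σ (α t) j)]
    · intro j' _ hj'
      exact expect_prod_maskedSign_mul_eq_zero Ω α i hi hj'.symm
    · simp
  refine (Finset.sum_le_sum fun j _ => h j).trans ?_
  simp

theorem expect_abs_sum_prod_maskedSign_le {d N p : ℕ} (hN : (d : ℝ) ^ (2 * p) ≤ N) (hd : 0 < d)
    (Ω : Finset (Fin d × Fin N)) (α : Fin p → Fin d) (i : Fin d)
    (hi : (Finset.univ.filter fun t => α t = i).card = 1) :
    𝔼 σ : Fin d × Fin N → ℤˣ, |∑ j, ∏ t, maskedSign Ω σ (α t) j| ≤ N / d ^ p := by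
  have hd' : (0 : ℝ) < (d : ℝ) ^ p := by positivity
  have hN0 : (0 : ℝ) < N := lt_of_lt_of_le (by positivity) hN
  -- AM-GM `x ≤ w / 2 + x² / (2w)` with `w = N / d ^ p`, the share of `N` allotted to each of the `d
  -- ^ p` words.
  have h1 : 𝔼 σ : Fin d × Fin N → ℤˣ, |∑ j, ∏ t, maskedSign Ω σ (α t) j| ≤
      𝔼 σ : Fin d × Fin N → ℤˣ, ((N / d ^ p / 2 : ℝ) +
        (d ^ p / N / 2) * (∑ j, ∏ t, maskedSign Ω σ (α t) j) ^ 2) := by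
    refine Finset.expect_le_expect fun σ _ => ?_
    rw [← sq_abs]
    set x := |∑ j, ∏ t, maskedSign Ω σ (α t) j|
    have h2 : (N / d ^ p / 2 : ℝ) + (d ^ p / N / 2) * x ^ 2 - x =
        (d ^ p / N / 2) * (x - N / d ^ p) ^ 2 := by field_simp; ring
    have h3 : 0 ≤ (d ^ p / N / 2 : ℝ) * (x - N / d ^ p) ^ 2 := by positivity
    linarith
  refine h1.trans ?_
  rw [Finset.expect_add_distrib, ← Finset.mul_expect, Finset.expect_const Finset.univ_nonempty]
  have h4 := expect_sq_sum_prod_maskedSign_le Ω α i hi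
  have h5 : (d ^ p / N / 2 : ℝ) * 𝔼 σ : Fin d × Fin N → ℤˣ,
      (∑ j, ∏ t, maskedSign Ω σ (α t) j) ^ 2 ≤ (d ^ p / N / 2) * N := by gcongr
  have h6 : (d ^ p / N / 2 * N : ℝ) ≤ N / d ^ p / 2 := by
    rw [div_right_comm, div_mul_cancel₀ _ hN0.ne', div_le_div_iff_of_pos_right two_pos,
      le_div_iff₀ hd', ← pow_add, ← two_mul]
    exact hN
  linarith

/-- The power expands over words `β`; all positions of `β` are sampled with probability at most `(m
/ (d * N))` to the number of distinct letters. -/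
theorem expect_card_column_pow_le {d N m q : ℕ} (hN : 0 < N) (hd : 0 < d) (hm : m ≤ d * N)
    (j : Fin N) :
    𝔼 Ω ∈ Finset.powersetCard m (Finset.univ : Finset (Fin d × Fin N)),
      ((Finset.univ.filter fun i => (i, j) ∈ Ω).card : ℝ) ^ q ≤ (q + (m : ℝ) / N) ^ q := by
  have h1 : ∀ Ω : Finset (Fin d × Fin N),
      ((Finset.univ.filter fun i => (i, j) ∈ Ω).card : ℝ) ^ q =
        ∑ β : Fin q → Fin d,
          if (Finset.univ.image β).image (fun i => (i, j)) ⊆ Ω then (1 : ℝ) else 0 := by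
    intro Ω
    rw [Finset.card_filter]
    push_cast
    rw [Fintype.sum_pow]
    refine Finset.sum_congr rfl fun β _ => ?_
    rw [Finset.prod_ite_zero]
    simp [Finset.image_subset_iff]
  simp_rw [h1]
  rw [Finset.expect_sum_comm]
  have h2 := sum_pow_card_image_le (κ := Fin d) (x := (m : ℝ) / (d * N)) (by positivity) q q le_rfl
  have h3 : (Fintype.card (Fin d) : ℝ) * ((m : ℝ) / (d * N)) = m / N := by
    have : (d : ℝ) ≠ 0 := by positivity
    rw [Fintype.card_fin]; field_simp
  rw [h3] at h2
  refine le_trans (Finset.sum_le_sum fun β _ => ?_) h2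
  refine (expect_ite_subset_le m (by simpa using hm) _).trans ?_
  rw [Finset.card_image_of_injective _ fun x y h => by simpa using h]
  simp

theorem sum_abs_sum_prod_maskedSign_le {d N p q : ℕ} (hp : 0 < p)
    (Ω : Finset (Fin d × Fin N)) (σ : Fin d × Fin N → ℤˣ) :
    ∑ α ∈ Finset.univ.filter fun α : Fin p → Fin d => (Finset.univ.image α).card ≤ q,
      |∑ j, ∏ t, maskedSign Ω σ (α t) j| ≤
    (q : ℝ) ^ p * ∑ j, ((Finset.univ.filter fun i => (i, j) ∈ Ω).card : ℝ) ^ q := by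
  refine (Finset.sum_le_sum fun α _ => Finset.abs_sum_le_sum_abs _ _).trans ?_
  rw [Finset.sum_comm, Finset.mul_sum]
  refine Finset.sum_le_sum fun j _ => ?_
  simp_rw [abs_prod_maskedSign]
  rw [Finset.sum_boole, Finset.filter_filter]
  have := card_words_le (q := q) hp (Finset.univ.filter fun i : Fin d => (i, j) ∈ Ω)
  simp only [Finset.mem_filter, Finset.mem_univ, true_and] at this
  simp_rw [and_comm (a := _ ≤ q)]
  exact_mod_cast this

theorem expect_sum_abs_sum_prod_maskedSign_le {d N p q m : ℕ} (hp : p = 2 * q) (hq : 0 < q)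
    (hd : 0 < d) (hN : (d : ℝ) ^ (2 * p) ≤ N) (hm : m ≤ d * N) :
    𝔼 Ω ∈ Finset.powersetCard m (Finset.univ : Finset (Fin d × Fin N)),
      𝔼 σ : Fin d × Fin N → ℤˣ, ∑ α : Fin p → Fin d, |∑ j, ∏ t, maskedSign Ω σ (α t) j| ≤
    N * (1 + (q : ℝ) ^ p * (q + (m : ℝ) / N) ^ q) := by
  have hN0 : 0 < N := by
    have : (0 : ℝ) < N := lt_of_lt_of_le (by positivity) hN
    exact_mod_cast this
  have hne : (Finset.powersetCard m (Finset.univ : Finset (Fin d × Fin N))).Nonempty :=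
    Finset.powersetCard_nonempty.2 (by simpa using hm)
  have key : ∀ Ω : Finset (Fin d × Fin N), 𝔼 σ : Fin d × Fin N → ℤˣ,
      ∑ α : Fin p → Fin d, |∑ j, ∏ t, maskedSign Ω σ (α t) j| ≤
      N + (q : ℝ) ^ p * ∑ j, ((Finset.univ.filter fun i => (i, j) ∈ Ω).card : ℝ) ^ q := by
    intro Ω
    simp_rw [← Finset.sum_filter_add_sum_filter_not (Finset.univ : Finset (Fin p → Fin d))
      (fun α => (Finset.univ.image α).card ≤ q)]
    rw [Finset.expect_add_distrib, add_comm]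
    refine add_le_add ?_ (Finset.expect_le Finset.univ_nonempty fun σ _ =>
      sum_abs_sum_prod_maskedSign_le (by omega) Ω σ)
    rw [Finset.expect_sum_comm]
    have h1 : ∀ α ∈ Finset.univ.filter fun α : Fin p → Fin d => ¬ (Finset.univ.image α).card ≤ q,
        𝔼 σ : Fin d × Fin N → ℤˣ, |∑ j, ∏ t, maskedSign Ω σ (α t) j| ≤ N / d ^ p := by
      intro α hα
      simp only [Finset.mem_filter, Finset.mem_univ, true_and, not_le] at hα
      obtain ⟨i, hi⟩ := exists_card_fiber_eq_one hp α hα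
      exact expect_abs_sum_prod_maskedSign_le hN hd Ω α i hi
    refine (Finset.sum_le_sum h1).trans ?_
    rw [Finset.sum_const, nsmul_eq_mul]
    have h2 : ((Finset.univ.filter fun α : Fin p → Fin d =>
        ¬ (Finset.univ.image α).card ≤ q).card : ℝ) ≤ d ^ p := by
      have := Finset.card_filter_le (Finset.univ : Finset (Fin p → Fin d))
        fun α => ¬ (Finset.univ.image α).card ≤ q
      simp only [Finset.card_univ, Fintype.card_pi, Fintype.card_fin, Finset.prod_const] at this
      exact_mod_cast this
    calc _ ≤ (d : ℝ) ^ p * (N / d ^ p) := by gcongr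
      _ = N := by
        have : (d : ℝ) ^ p ≠ 0 := by positivity
        field_simp
  refine (Finset.expect_le_expect fun Ω _ => key Ω).trans ?_
  rw [Finset.expect_add_distrib, Finset.expect_const hne, ← Finset.mul_expect,
    Finset.expect_sum_comm]
  have h3 : ∑ j : Fin N, 𝔼 Ω ∈ Finset.powersetCard m (Finset.univ : Finset (Fin d × Fin N)),
      ((Finset.univ.filter fun i => (i, j) ∈ Ω).card : ℝ) ^ q ≤ N * (q + (m : ℝ) / N) ^ q := by
    refine (Finset.sum_le_sum fun j _ => expect_card_column_pow_le hN0 hd hm j).trans ?_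
    simp
  have h4 : (q : ℝ) ^ p * ∑ j : Fin N,
      𝔼 Ω ∈ Finset.powersetCard m (Finset.univ : Finset (Fin d × Fin N)),
      ((Finset.univ.filter fun i => (i, j) ∈ Ω).card : ℝ) ^ q ≤
      (q : ℝ) ^ p * (N * (q + (m : ℝ) / N) ^ q) := by gcongr
  linarith

/-! ### Deterministic bounds on the relaxation -/

theorem exists_functional_of_satisfiesFactorConstraints {d r N D p a : ℕ} {k : ℝ}
    {C : Matrix (Fin d) (Fin N) ℝ} {E : PseudoExpectation (FactorVar d r N) D}
    (hE : SatisfiesFactorConstraints p k C E) (ha : 1 ≤ a) (hp : p = 2 ^ a) (hD : p ≤ D) :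
    ∃ f : MvPolynomial (FactorVar d r N) ℝ →ₗ[ℝ] ℝ,
      (∀ q : MvPolynomial (FactorVar d r N) ℝ, 2 * q.totalDegree ≤ D → 0 ≤ f (q ^ 2)) ∧
      (∀ i j, C i j = ∑ l, f (MvPolynomial.X (FactorVar.A i l) *
        MvPolynomial.X (FactorVar.b l j) ^ (p - 1))) ∧
      (∀ j, ∑ l, f (MvPolynomial.X (FactorVar.b l j) ^ p) ≤ k ^ ((p : ℝ) / ((p : ℝ) - 1))) ∧
      ∀ l (α : Fin p → Fin d), |f (∏ t, MvPolynomial.X (FactorVar.A (α t) l))| ≤ 1 := by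
  obtain ⟨f, hf⟩ := E.exists_extension
  have hp2 : 2 ≤ p := by
    rw [hp]; calc 2 = 2 ^ 1 := rfl
      _ ≤ 2 ^ a := Nat.pow_le_pow_right (by norm_num) ha
  have hmem : ∀ q : MvPolynomial (FactorVar d r N) ℝ, q ∈ PolyLE _ D ↔ q.totalDegree ≤ D :=
    fun q => MvPolynomial.mem_restrictTotalDegree _ _ _
  have hX : ∀ v : FactorVar d r N, (MvPolynomial.X v : MvPolynomial _ ℝ).totalDegree ≤ 1 :=
    fun v => (MvPolynomial.totalDegree_X v).le
  have hXp : ∀ (v : FactorVar d r N) n, (MvPolynomial.X v ^ n : MvPolynomial _ ℝ).totalDegree ≤ n :=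
    fun v n => (MvPolynomial.totalDegree_X_pow v n).le
  have h1 : f 1 = 1 := by rw [← hf 1 (one_mem_polyLE _ _), E.map_one]
  have hsq : ∀ q : MvPolynomial (FactorVar d r N) ℝ, 2 * q.totalDegree ≤ D → 0 ≤ f (q ^ 2) := by
    intro q hq
    rw [← hf _ (sq_mem_polyLE hq)]
    exact E.sq_nonneg q hq
  refine ⟨f, hsq, fun i j => ?_, fun j => ?_, fun l α => ?_⟩
  · have hB : ∀ l, f (MvPolynomial.X (FactorVar.A i l) * MvPolynomial.X (FactorVar.B l j)) =
        f (MvPolynomial.X (FactorVar.A i l) * MvPolynomial.X (FactorVar.b l j) ^ (p - 1)) := by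
      intro l
      have hdeg : (MvPolynomial.X (FactorVar.B l j) - MvPolynomial.X (FactorVar.b l j) ^ (p - 1)) *
          MvPolynomial.X (FactorVar.A i l) ∈ PolyLE (FactorVar d r N) D := by
        rw [hmem]
        refine (MvPolynomial.totalDegree_mul _ _).trans ?_
        have a1 := MvPolynomial.totalDegree_sub
          (MvPolynomial.X (FactorVar.B l j) : MvPolynomial (FactorVar d r N) ℝ)
          (MvPolynomial.X (FactorVar.b l j) ^ (p - 1))
        have a2 := hX (FactorVar.B l j)
        have a3 := hXp (FactorVar.b l j) (p - 1)
        have a4 := hX (FactorVar.A i l)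
        omega
      have h := hE.eq_pow l j (MvPolynomial.X (FactorVar.A i l)) hdeg
      rw [hf, sub_mul, map_sub, sub_eq_zero] at h
      rwa [mul_comm, mul_comm (MvPolynomial.X (FactorVar.A i l))]
    have hdeg : (MvPolynomial.C (C i j) -
        ∑ l : Fin r, MvPolynomial.X (FactorVar.A i l) * MvPolynomial.X (FactorVar.B l j)) * 1 ∈
          PolyLE (FactorVar d r N) D := by
      rw [hmem, mul_one]
      refine (MvPolynomial.totalDegree_sub _ _).trans (max_le (by simp) ?_)
      refine (MvPolynomial.totalDegree_finsetSum_le (d := 2) fun l _ => ?_).trans (hp2.trans hD)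
      refine (MvPolynomial.totalDegree_mul _ _).trans ?_
      have a2 := hX (FactorVar.B l j)
      have a4 := hX (FactorVar.A i l)
      omega
    have h := hE.eq_mul i j 1 hdeg
    rw [hf, mul_one, map_sub, sub_eq_zero, map_sum, ← mul_one (MvPolynomial.C (C i j)),
      ← MvPolynomial.smul_eq_C_mul, map_smul, h1, smul_eq_mul, mul_one] at h
    rw [h]
    exact Finset.sum_congr rfl fun l _ => hB l
  · have hdeg : (MvPolynomial.C (k ^ ((p : ℝ) / ((p : ℝ) - 1))) -
        ∑ l : Fin r, MvPolynomial.X (FactorVar.b l j) ^ p) * 1 ^ 2 ∈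
          PolyLE (FactorVar d r N) D := by
      rw [hmem, one_pow, mul_one]
      refine (MvPolynomial.totalDegree_sub _ _).trans (max_le (by simp) ?_)
      exact (MvPolynomial.totalDegree_finsetSum_le (d := p) fun l _ => hXp _ _).trans hD
    have h := hE.sum_le j 1 hdeg
    rw [hf, one_pow, mul_one, map_sub, map_sum,
      ← mul_one (MvPolynomial.C (k ^ ((p : ℝ) / ((p : ℝ) - 1)))),
      ← MvPolynomial.smul_eq_C_mul, map_smul, h1, smul_eq_mul, mul_one] at h
    linarith
  · obtain ⟨b, rfl⟩ : ∃ b, a = b + 1 := ⟨a - 1, by omega⟩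
    have hpq : p = 2 * 2 ^ b := by rw [hp, pow_succ, mul_comm]
    refine abs_map_prod_le_one (D := D) (q := 2 ^ b) f h1 hsq
      (fun t => MvPolynomial.X (FactorVar.A (α t) l)) (fun t => hX _) (fun t s hs => ?_)
      (by rw [Fintype.card_fin, hpq]) (by omega)
    have hdeg : (1 - MvPolynomial.X (FactorVar.A (α t) l) ^ 2) * s ^ 2 ∈
        PolyLE (FactorVar d r N) D := by
      rw [hmem]
      refine (MvPolynomial.totalDegree_mul _ _).trans ?_
      have a1 := MvPolynomial.totalDegree_sub
        (1 : MvPolynomial (FactorVar d r N) ℝ) (MvPolynomial.X (FactorVar.A (α t) l) ^ 2)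
      have a2 := hXp (FactorVar.A (α t) l) 2
      have a3 := MvPolynomial.totalDegree_pow s 2
      rw [MvPolynomial.totalDegree_one] at a1
      omega
    have h := hE.sq_le (α t) l s hdeg
    rwa [hf] at h

/-- Young's inequality applied to `s • x` and `u • y`; `hsu` keeps the mixed term unscaled. The set
`J` is all columns for the width and a single column for the entry bound. -/
theorem sum_mul_le_of_mem_sosRelaxation {d r N D p a : ℕ} {k : ℝ}
    {C : Matrix (Fin d) (Fin N) ℝ} (hC : C ∈ sosRelaxation d N r p D k)
    (ha : 1 ≤ a) (hp : p = 2 ^ a) (hD : p ≤ D) (M : Fin d → Fin N → ℝ) (J : Finset (Fin N))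
    {s u H : ℝ} (hs : 0 ≤ s) (hu : 0 ≤ u) (hsu : s * u ^ (p - 1) = 1)
    (hH : k ^ ((p : ℝ) / ((p : ℝ) - 1)) ≤ H) :
    (p : ℝ) * ∑ j ∈ J, ∑ i, M i j * C i j ≤
      s ^ p * (r * ∑ α : Fin p → Fin d, |∑ j ∈ J, ∏ t, M (α t) j|) +
        ((p : ℝ) - 1) * (u ^ p * (J.card * H)) := by
  obtain ⟨E, hE⟩ := hC
  obtain ⟨f, hsq, hfC, hfb, hfA⟩ := exists_functional_of_satisfiesFactorConstraints hE ha hp hD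
  have hp1 : (1 : ℝ) ≤ p := by
    have : 1 ≤ p := hp ▸ Nat.one_le_two_pow
    exact_mod_cast this
  set x : Fin r → Fin N → MvPolynomial (FactorVar d r N) ℝ := fun l j =>
    ∑ i, M i j • MvPolynomial.X (FactorVar.A i l) with hx
  set y : Fin r → Fin N → MvPolynomial (FactorVar d r N) ℝ := fun l j =>
    MvPolynomial.X (FactorVar.b l j) with hy
  have hyoung : ∀ l j, (p : ℝ) * f (x l j * y l j ^ (p - 1)) ≤
      s ^ p * f (x l j ^ p) + ((p : ℝ) - 1) * (u ^ p * f (y l j ^ p)) := by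
    intro l j
    have h := young_two_pow f hsq a 1 (s • x l j) (u • y l j)
      ((MvPolynomial.totalDegree_smul_le _ _).trans
        (MvPolynomial.totalDegree_finsetSum_le fun i _ =>
          (MvPolynomial.totalDegree_smul_le _ _).trans (MvPolynomial.totalDegree_X _).le))
      ((MvPolynomial.totalDegree_smul_le _ _).trans (MvPolynomial.totalDegree_X _).le)
      (by rw [mul_one, ← hp]; exact hD)
    have hc : (2 : ℝ) ^ a = p := by rw [hp]; push_cast; rfl
    rw [← hp, hc] at h
    simp only [smul_pow, smul_mul_smul_comm, map_smul, smul_eq_mul, hsu, one_mul] at h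
    exact h
  have h1 : ∑ j ∈ J, ∑ i, M i j * C i j = ∑ j ∈ J, ∑ l, f (x l j * y l j ^ (p - 1)) := by
    refine Finset.sum_congr rfl fun j _ => ?_
    simp only [hx, hfC, Finset.mul_sum, Finset.sum_mul, map_sum, smul_mul_assoc, map_smul,
      smul_eq_mul]
    exact Finset.sum_comm
  have h2 : ∀ l, ∑ j ∈ J, f (x l j ^ p) ≤
      ∑ α : Fin p → Fin d, |∑ j ∈ J, ∏ t, M (α t) j| := by
    intro l
    simp only [hx, Fintype.sum_pow, Finset.prod_smul, map_sum, map_smul, smul_eq_mul]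
    rw [Finset.sum_comm]
    refine Finset.sum_le_sum fun α _ => ?_
    rw [← Finset.sum_mul]
    refine (le_abs_self _).trans ?_
    rw [abs_mul]
    exact mul_le_of_le_one_right (abs_nonneg _) (hfA l α)
  have h3 : ∑ j ∈ J, ∑ l, f (y l j ^ p) ≤ J.card * H := by
    refine (Finset.sum_le_sum fun j _ => (hfb j).trans hH).trans ?_
    simp
  have h4 : ∑ j ∈ J, ∑ l, f (x l j ^ p) ≤
      r * ∑ α : Fin p → Fin d, |∑ j ∈ J, ∏ t, M (α t) j| := by
    rw [Finset.sum_comm]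
    refine (Finset.sum_le_sum fun l _ => h2 l).trans ?_
    simp
  rw [h1, Finset.mul_sum]
  simp_rw [Finset.mul_sum]
  refine (Finset.sum_le_sum fun j _ => Finset.sum_le_sum fun l _ => hyoung l j).trans ?_
  simp_rw [Finset.sum_add_distrib, ← Finset.mul_sum]
  have hp1' : 0 ≤ (p : ℝ) - 1 := by linarith
  gcongr

/-- Weights that balance the two sides of Young's inequality and so recover Hölder: `s = z / g`, `u
= z / h` with `z ^ p = g * h ^ (p - 1)`. -/
theorem exists_holder_weights {p : ℕ} (hp : 1 ≤ p) {g h : ℝ} (hg : 0 < g) (hh : 0 < h) :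
    ∃ s u : ℝ, 0 < s ∧ 0 < u ∧ s * u ^ (p - 1) = 1 ∧ s ^ p * g ^ p = g * h ^ (p - 1) ∧
      u ^ p * h ^ p = g * h ^ (p - 1) := by
  obtain ⟨n, rfl⟩ : ∃ n, p = n + 1 := ⟨p - 1, by omega⟩
  have hZ : 0 < g * h ^ n := by positivity
  set z := (g * h ^ n) ^ ((1 : ℝ) / ((n + 1 : ℕ) : ℝ)) with hz
  have hz0 : 0 < z := by positivity
  have hzp : z ^ (n + 1) = g * h ^ n := by
    rw [hz, one_div]
    exact Real.rpow_inv_natCast_pow hZ.le (by omega)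
  refine ⟨z / g, z / h, by positivity, by positivity, ?_, ?_, ?_⟩
  · rw [Nat.add_sub_cancel, div_pow, div_mul_div_comm, ← pow_succ', hzp, div_self hZ.ne']
  · rw [← mul_pow, div_mul_cancel₀ _ hg.ne', hzp, Nat.add_sub_cancel]
  · rw [← mul_pow, div_mul_cancel₀ _ hh.ne', hzp, Nat.add_sub_cancel]

theorem abs_entry_le_of_mem_sosRelaxation {d r N D p a : ℕ} {k : ℝ}
    {C : Matrix (Fin d) (Fin N) ℝ} (hC : C ∈ sosRelaxation d N r p D k)
    (ha : 1 ≤ a) (hp : p = 2 ^ a) (hD : p ≤ D) {g h : ℝ} (hg : 0 < g) (hh : 0 < h)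
    (hr : (r : ℝ) ≤ g ^ p) (hk : k ^ ((p : ℝ) / ((p : ℝ) - 1)) ≤ h ^ p) (i : Fin d) (j : Fin N) :
    |C i j| ≤ g * h ^ (p - 1) := by
  have hp1 : 1 ≤ p := hp ▸ Nat.one_le_two_pow
  have hp1' : (1 : ℝ) ≤ p := by exact_mod_cast hp1
  obtain ⟨s, u, hs, hu, hsu, hsg, huh⟩ := exists_holder_weights hp1 hg hh
  have key : ∀ ε : ℝ, |ε| = 1 → ε * C i j ≤ g * h ^ (p - 1) := by
    intro ε hε
    have h1 := sum_mul_le_of_mem_sosRelaxation hC ha hp hD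
      (fun i' _ => if i' = i then ε else 0) {j} hs.le hu.le hsu hk
    -- Only the constant word `i` contributes.
    have h2 : ∑ α : Fin p → Fin d, |∏ t, if α t = i then ε else 0| = 1 := by
      simp_rw [Finset.abs_prod]
      rw [← Fintype.sum_pow (fun a : Fin d => |if a = i then ε else 0|)]
      simp [apply_ite abs, hε]
    simp only [Finset.sum_singleton, ite_mul, zero_mul, Finset.sum_ite_eq', Finset.mem_univ,
      if_true, h2, mul_one, Finset.card_singleton, Nat.cast_one, one_mul, huh] at h1
    have h3 : s ^ p * r ≤ g * h ^ (p - 1) := by rw [← hsg]; gcongr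
    nlinarith
  rw [abs_le]
  have h1 := key 1 (by simp)
  have h2 := key (-1) (by simp)
  constructor <;> linarith

/-! ### Bounds on the width -/

theorem samplingRademacherWidth_le_of_abs_le {ι : Type*} [Fintype ι] [DecidableEq ι] {m : ℕ}
    {W : Set (ι → ℝ)} (hm : 1 ≤ m) (hmc : m ≤ Fintype.card ι) (hW : W.Nonempty) {v : ℝ}
    (hv : ∀ x ∈ W, ∀ i, |x i| ≤ v) : samplingRademacherWidth m W ≤ v := by
  have hm0 : (0 : ℝ) < m := by exact_mod_cast hm
  unfold samplingRademacherWidth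
  refine Finset.expect_le (Finset.powersetCard_nonempty.2 (by simpa using hmc)) fun Ω hΩ =>
    Finset.expect_le Finset.univ_nonempty fun σ _ => ?_
  rw [one_div, inv_mul_le_iff₀ hm0]
  refine csSup_le (hW.image _) ?_
  rintro _ ⟨x, hx, rfl⟩
  refine (Finset.sum_le_sum (g := fun _ => v) fun i _ => ?_).trans ?_
  · refine (le_abs_self _).trans ?_
    have : |((σ i : ℤ) : ℝ)| = 1 := by
      rcases Int.units_eq_one_or (σ i) with h | h <;> simp [h]
    rw [abs_mul, this, mul_one]
    exact hv x hx i
  · rw [Finset.sum_const, (Finset.mem_powersetCard.1 hΩ).2, nsmul_eq_mul]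

/-- Evaluation at the origin is a pseudo-expectation for `C = 0`. -/
theorem sosRelaxation_nonempty {d N r p D : ℕ} {k : ℝ} (hk : 0 ≤ k) (hp : 2 ≤ p) :
    (sosRelaxation d N r p D k).Nonempty := by
  refine ⟨0, ⟨(MvPolynomial.aeval (fun _ => (0 : ℝ))).toLinearMap ∘ₗ (PolyLE _ D).subtype,
    by simp, fun q h => by simpa using sq_nonneg _⟩, ⟨?_, ?_, ?_, ?_⟩⟩
  · intro l j s h
    simp [show p - 1 ≠ 0 by omega]
  · intro j s h
    simp [show p ≠ 0 by omega]
    positivity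
  · intro i l s h
    simpa using sq_nonneg _
  · intro i j s h
    simp

theorem samplingRademacherWidth_sosRelaxation_le_of_le {d r N D p q a m : ℕ} {k : ℝ} (hk0 : 0 ≤ k)
    (ha : 1 ≤ a) (hp : p = 2 ^ a) (hpq : p = 2 * q) (hD : p ≤ D) (hd : 0 < d)
    (hN : (d : ℝ) ^ (2 * p) ≤ N) (hm : m ≤ d * N) (hqm : (q : ℝ) ≤ m / N) {g h : ℝ}
    (hg : 0 < g) (hh : 0 < h)
    (hr : (r : ℝ) ≤ g ^ p) (hk : k ^ ((p : ℝ) / ((p : ℝ) - 1)) ≤ h ^ p) :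
    samplingRademacherWidth m (matrixEntries '' sosRelaxation d N r p D k) ≤
      g * h ^ (p - 1) * (p * Real.sqrt (N / m)) := by
  have hp1 : 1 ≤ p := hp ▸ Nat.one_le_two_pow
  have hq : 1 ≤ q := by omega
  have hq' : (1 : ℝ) ≤ q := by exact_mod_cast hq
  have hpr : (p : ℝ) = 2 * q := by rw [hpq]; push_cast; rfl
  have hp0 : (0 : ℝ) < p := by exact_mod_cast hp1
  have hN0 : (0 : ℝ) < N := lt_of_lt_of_le (by positivity) hN
  have ht : (0 : ℝ) < m / N := by linarith
  have hm0 : (0 : ℝ) < m := by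
    rcases (Nat.cast_nonneg m : (0 : ℝ) ≤ m).eq_or_lt with h | h
    · rw [← h] at ht; simp at ht
    · exact h
  set T : ℝ := p * Real.sqrt (m / N) with hT
  have hT0 : 0 < T := by positivity
  -- Since `q ≤ m / N`, the moment term is at most `(2 q² m / N) ^ q`; the spare factor `2 ^ q` in
  -- `T ^ p` absorbs the `1`.
  have hTp : 1 + (q : ℝ) ^ p * (q + (m : ℝ) / N) ^ q ≤ T ^ p := by
    have e1 : T ^ p = (2 * (2 * q ^ 2 * (m / N))) ^ q := by
      rw [hpq, pow_mul, hT, mul_pow, Real.sq_sqrt ht.le, hpr]; ring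
    have e2 : (q : ℝ) ^ p * (q + (m : ℝ) / N) ^ q = (q ^ 2 * (q + m / N)) ^ q := by
      rw [hpq, pow_mul, mul_pow]
    have e3 : ((q : ℝ) ^ 2 * (q + m / N)) ^ q ≤ (2 * q ^ 2 * (m / N)) ^ q := by
      refine pow_le_pow_left₀ (by positivity) ?_ q
      nlinarith [sq_nonneg (q : ℝ)]
    have e4 : (1 : ℝ) ≤ (2 * q ^ 2 * (m / N)) ^ q := by
      refine one_le_pow₀ ?_
      nlinarith [one_le_pow₀ hq' (n := 2)]
    have e5 : (2 : ℝ) ≤ 2 ^ q := by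
      calc (2 : ℝ) = 2 ^ 1 := by norm_num
        _ ≤ 2 ^ q := pow_le_pow_right₀ (by norm_num) hq
    rw [e1, e2, mul_pow 2]
    nlinarith
  obtain ⟨s, u, hs, hu, hsu, hsg, huh⟩ := exists_holder_weights hp1 (mul_pos hg hT0) hh
  set Z := g * T * h ^ (p - 1) with hZ
  have hne : (Finset.powersetCard m (Finset.univ : Finset (Fin d × Fin N))).Nonempty :=
    Finset.powersetCard_nonempty.2 (by simpa using hm)
  have hbound : ∀ (Ω : Finset (Fin d × Fin N)) (σ : Fin d × Fin N → ℤˣ),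
      (1 / (m : ℝ)) * sSup ((fun x : Fin d × Fin N → ℝ => ∑ i ∈ Ω, x i * ((σ i : ℤ) : ℝ)) ''
        (matrixEntries '' sosRelaxation d N r p D k)) ≤
      (1 / (m * p) * (s ^ p * r)) * (∑ α : Fin p → Fin d, |∑ j, ∏ t, maskedSign Ω σ (α t) j|) +
        1 / (m * p) * (((p : ℝ) - 1) * (N * Z)) := by
    intro Ω σ
    have h1 : sSup ((fun x : Fin d × Fin N → ℝ => ∑ i ∈ Ω, x i * ((σ i : ℤ) : ℝ)) ''
        (matrixEntries '' sosRelaxation d N r p D k)) ≤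
        1 / p * (s ^ p * (r * ∑ α : Fin p → Fin d, |∑ j, ∏ t, maskedSign Ω σ (α t) j|) +
          ((p : ℝ) - 1) * (N * Z)) := by
      refine csSup_le (((sosRelaxation_nonempty hk0 (by omega)).image _).image _) ?_
      rintro _ ⟨_, ⟨C, hC, rfl⟩, rfl⟩
      rw [one_div, le_inv_mul_iff₀ hp0]
      have h2 := sum_mul_le_of_mem_sosRelaxation hC ha hp hD (maskedSign Ω σ) Finset.univ
        hs.le hu.le hsu hk
      rw [Finset.card_univ, Fintype.card_fin, mul_left_comm (u ^ p), huh] at h2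
      refine le_of_eq_of_le ?_ h2
      congr 1
      rw [Finset.sum_comm,
        ← Fintype.sum_prod_type' (f := fun i j => maskedSign Ω σ i j * C i j)]
      simp [maskedSign, matrixEntries, mul_comm]
    refine (mul_le_mul_of_nonneg_left h1 (by positivity)).trans_eq ?_
    field_simp
  unfold samplingRademacherWidth
  refine (Finset.expect_le_expect fun Ω _ => Finset.expect_le_expect fun σ _ =>
    hbound Ω σ).trans ?_
  simp_rw [Finset.expect_add_distrib, ← Finset.mul_expect]
  rw [Finset.expect_const Finset.univ_nonempty, Finset.expect_const hne]
  have hmean := expect_sum_abs_sum_prod_maskedSign_le hpq (by omega) hd hN hm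
  have h1 := hmean.trans (mul_le_mul_of_nonneg_left hTp hN0.le)
  have h2 : (s ^ p * r) * (N * T ^ p) ≤ N * Z := by
    rw [← hsg, mul_pow g T]
    calc (s ^ p * r) * (N * T ^ p) ≤ (s ^ p * g ^ p) * (N * T ^ p) := by gcongr
      _ = _ := by ring
  calc _ ≤ 1 / (m * p) * (s ^ p * r) * (N * T ^ p) + 1 / (m * p) * ((p - 1) * (N * Z)) := by
        gcongr
    _ = 1 / (m * p) * ((s ^ p * r) * (N * T ^ p)) + 1 / (m * p) * ((p - 1) * (N * Z)) := by ring
    _ ≤ 1 / (m * p) * (N * Z) + 1 / (m * p) * ((p - 1) * (N * Z)) := by gcongr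
    _ = (N / m) * Z := by field_simp; ring
    _ = g * h ^ (p - 1) * (p * ((N / m) * Real.sqrt (m / N))) := by rw [hZ, hT]; ring
    _ = _ := by
      have e : (m : ℝ) / N = ((N : ℝ) / m)⁻¹ := by rw [inv_div]
      rw [e, Real.sqrt_inv, ← div_eq_mul_inv, Real.div_sqrt]

theorem samplingRademacherWidth_sosRelaxation_le {d r N D p a m : ℕ} {k : ℝ} (hk0 : 0 ≤ k)
    (ha : 1 ≤ a) (hp : p = 2 ^ a) (hD : p ≤ D) (hd : 0 < d) (hm1 : 1 ≤ m)
    (hN : (d : ℝ) ^ (2 * p) ≤ N) (hm : m ≤ d * N) {g h : ℝ} (hg : 0 < g) (hh : 0 < h)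
    (hr : (r : ℝ) ≤ g ^ p) (hk : k ^ ((p : ℝ) / ((p : ℝ) - 1)) ≤ h ^ p) :
    samplingRademacherWidth m (matrixEntries '' sosRelaxation d N r p D k) ≤
      g * h ^ (p - 1) * (p * Real.sqrt (N / m)) := by
  obtain ⟨b, rfl⟩ : ∃ b, a = b + 1 := ⟨a - 1, by omega⟩
  have hpq : p = 2 * 2 ^ b := by rw [hp, pow_succ, mul_comm]
  have hb : 1 ≤ 2 ^ b := Nat.one_le_two_pow
  -- Otherwise `N / m > 2 / p`, so `p * √(N / m) ≥ 1` and the entry bound is enough.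
  by_cases hqm : ((2 ^ b : ℕ) : ℝ) ≤ m / N
  · exact samplingRademacherWidth_sosRelaxation_le_of_le hk0 ha hp hpq hD hd hN hm hqm hg hh hr hk
  have hN0 : (0 : ℝ) < N := lt_of_lt_of_le (by positivity) hN
  have hm0 : (0 : ℝ) < m := by exact_mod_cast hm1
  have hv : samplingRademacherWidth m (matrixEntries '' sosRelaxation d N r p D k) ≤
      g * h ^ (p - 1) := by
    refine samplingRademacherWidth_le_of_abs_le hm1 (by simpa using hm)
      ((sosRelaxation_nonempty hk0 (by omega)).image _) ?_
    rintro _ ⟨C, hC, rfl⟩ ⟨i, j⟩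
    exact abs_entry_le_of_mem_sosRelaxation hC ha hp hD hg hh hr hk i j
  refine hv.trans (le_mul_of_one_le_right (by positivity) ?_)
  have hpb : (p : ℝ) = 2 * (2 ^ b : ℕ) := by exact_mod_cast hpq
  have hb' : (1 : ℝ) ≤ (2 ^ b : ℕ) := by exact_mod_cast hb
  rw [not_le, div_lt_iff₀ hN0] at hqm
  have h1 : (1 : ℝ) / p ≤ Real.sqrt (N / m) := by
    refine Real.le_sqrt_of_sq_le ?_
    rw [div_pow, one_pow, div_le_div_iff₀ (by rw [hpb]; positivity) hm0, hpb]
    nlinarith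
  rwa [div_le_iff₀' (by rw [hpb]; positivity)] at h1

theorem sqrt_width_bound_eq {p N r m : ℕ} {k : ℝ} (hp : 2 ≤ p) (hk : 0 ≤ k) (d : ℕ) :
    Real.sqrt ((p : ℝ) ^ 2 * (N : ℝ) * k ^ 2 * (r : ℝ) ^ ((2 : ℝ) / (p : ℝ)) *
        Real.log (d : ℝ) / (m : ℝ)) =
      (r : ℝ) ^ ((1 : ℝ) / p) * k * (p * Real.sqrt (N / m)) * Real.sqrt (Real.log d) := by
  have e : (r : ℝ) ^ ((2 : ℝ) / (p : ℝ)) = ((r : ℝ) ^ ((1 : ℝ) / p)) ^ 2 := by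
    rw [← Real.rpow_natCast, ← Real.rpow_mul (by positivity)]
    congr 1
    push_cast; ring
  rw [e, show (p : ℝ) ^ 2 * (N : ℝ) * k ^ 2 * ((r : ℝ) ^ ((1 : ℝ) / p)) ^ 2 *
        Real.log (d : ℝ) / (m : ℝ) =
      (((r : ℝ) ^ ((1 : ℝ) / p)) * k * p) ^ 2 * ((N / m) * Real.log d) by ring,
    Real.sqrt_mul (by positivity), Real.sqrt_sq (by positivity), Real.sqrt_mul (by positivity)]
  ring

theorem theorem8 :
    ∃ (K₀ : ℕ) (c₁ K : ℝ), 0 < c₁ ∧ 0 < K ∧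
      ∀ (a p d N r m D : ℕ) (c₀ k : ℝ),
        1 ≤ a → p = 2 ^ a → 2 ≤ d → c₁ ≤ c₀ → (N : ℝ) = (d : ℝ) ^ (c₀ * (p : ℝ)) →
        0 ≤ k → 1 ≤ m → m ≤ d * N → K₀ * p ^ 2 ≤ D →
          (sosRelaxation d N r p D k).Nonempty ∧
          Bornology.IsBounded (matrixEntries '' sosRelaxation d N r p D k) ∧
          samplingRademacherWidth m (matrixEntries '' sosRelaxation d N r p D k) ≤
            K * Real.sqrt ((p : ℝ) ^ 2 * (N : ℝ) * k ^ 2 * (r : ℝ) ^ ((2 : ℝ) / (p : ℝ)) *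
              Real.log (d : ℝ) / (m : ℝ)) := by
  -- `K₀ = 1` yields `p ≤ D`, all the degree that is needed; `c₁ = 2` yields `d ^ (2 * p) ≤ N`; `K =
  -- 2` compensates `√(log d) ≥ 1 / 2`.
  refine ⟨1, 2, 2, by norm_num, by norm_num, ?_⟩
  intro a p d N r m D c₀ k ha hp hd hc hN hk hm1 hm hD
  have hp2 : 2 ≤ p := by
    rw [hp]; calc 2 = 2 ^ 1 := rfl
      _ ≤ 2 ^ a := Nat.pow_le_pow_right (by norm_num) ha
  have hpD : p ≤ D := by nlinarith
  have hp2' : (2 : ℝ) ≤ p := by exact_mod_cast hp2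
  have hd1 : (1 : ℝ) ≤ d := by exact_mod_cast (by omega : 1 ≤ d)
  have hNd : (d : ℝ) ^ (2 * p) ≤ N := by
    rw [hN, ← Real.rpow_natCast]
    refine Real.rpow_le_rpow_of_exponent_le hd1 ?_
    push_cast
    gcongr
  set τ : ℝ := (r : ℝ) ^ ((1 : ℝ) / p) with hτ
  set κ : ℝ := k ^ ((1 : ℝ) / ((p : ℝ) - 1)) with hκ
  have hτ0 : 0 ≤ τ := by positivity
  have hκ0 : 0 ≤ κ := by positivity
  have hτp : τ ^ p = r := by
    rw [hτ, one_div]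
    exact Real.rpow_inv_natCast_pow (by positivity) (by omega)
  have hκp : κ ^ p = k ^ ((p : ℝ) / ((p : ℝ) - 1)) := by
    rw [hκ, ← Real.rpow_natCast, ← Real.rpow_mul hk]
    congr 1
    ring
  have hκk : κ ^ (p - 1) = k := by
    have e : ((p : ℝ) - 1) = ((p - 1 : ℕ) : ℝ) := by push_cast [show 1 ≤ p by omega]; rfl
    rw [hκ, e, one_div]
    exact Real.rpow_inv_natCast_pow hk (by omega)
  have hτε : ∀ ε : ℝ, 0 < ε → (r : ℝ) ≤ (τ + ε) ^ p := fun ε hε => by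
    rw [← hτp]; gcongr; linarith
  have hκε : ∀ ε : ℝ, 0 < ε → k ^ ((p : ℝ) / ((p : ℝ) - 1)) ≤ (κ + ε) ^ p := fun ε hε => by
    rw [← hκp]; gcongr; linarith
  refine ⟨sosRelaxation_nonempty hk hp2, ?_, ?_⟩
  · refine isBounded_iff_forall_norm_le.2 ⟨(τ + 1) * (κ + 1) ^ (p - 1), ?_⟩
    rintro _ ⟨C, hC, rfl⟩
    rw [pi_norm_le_iff_of_nonneg (by positivity)]
    rintro ⟨i, j⟩
    exact abs_entry_le_of_mem_sosRelaxation hC ha hp hpD (by positivity) (by positivity)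
      (hτε 1 one_pos) (hκε 1 one_pos) i j
  -- The Hölder weights need positive `g, h`, while `r` or `k` may vanish; hence a perturbation by
  -- `ε`, followed by `ε → 0`.
  · have hε : ∀ ε : ℝ, 0 < ε →
        samplingRademacherWidth m (matrixEntries '' sosRelaxation d N r p D k) ≤
          (τ + ε) * (κ + ε) ^ (p - 1) * (p * Real.sqrt (N / m)) := fun ε hε =>
      samplingRademacherWidth_sosRelaxation_le hk ha hp hpD (by omega) hm1 hNd hm
        (by positivity) (by positivity) (hτε ε hε) (hκε ε hε)
    have hlim : Filter.Tendsto
        (fun ε : ℝ => (τ + ε) * (κ + ε) ^ (p - 1) * (p * Real.sqrt (N / m)))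
        (nhdsWithin 0 (Set.Ioi 0)) (nhds (τ * k * (p * Real.sqrt (N / m)))) := by
      have hcont : Continuous
          (fun ε : ℝ => (τ + ε) * (κ + ε) ^ (p - 1) * (p * Real.sqrt (N / m))) := by fun_prop
      have := (hcont.tendsto 0).mono_left (nhdsWithin_le_nhds (s := Set.Ioi 0))
      simpa [hκk] using this
    have hmain : samplingRademacherWidth m (matrixEntries '' sosRelaxation d N r p D k) ≤
        τ * k * (p * Real.sqrt (N / m)) :=
      ge_of_tendsto hlim (Filter.eventually_of_mem self_mem_nhdsWithin fun ε h => hε ε h)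
    refine hmain.trans ?_
    rw [sqrt_width_bound_eq hp2 hk, ← hτ]
    have hlog : 1 / 2 ≤ Real.sqrt (Real.log d) := by
      refine Real.le_sqrt_of_sq_le ?_
      have h1 : Real.log 2 ≤ Real.log d :=
        Real.log_le_log (by norm_num) (by exact_mod_cast hd)
      have := Real.log_two_gt_d9
      norm_num
      linarith
    have h0 : 0 ≤ τ * k * (p * Real.sqrt (N / m)) := by positivity
    nlinarith
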